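/- Let $M$ be a smooth manifold of dimension $n\ge 2$ with a Finsler metric $F:TM\to[0,\infty)$, i.e. $F$ is smooth on $TM\setminus 0$, $F(x,\lambda y)=\lambda F(x,y)$ for $\lambda>0$, and $g_{ij}(x,y)=\tfrac12\,\partial^2F^2/\partial y^i\partial y^j$ is positive definite for $y\neq0$. In induced coordinates $(x^i,y^i)$ on $TM\setminus0$ put $$G^i=\tfrac14 g^{ij}\Big(\frac{\partial^2F^2}{\partial y^j\partial x^k}y^k-\frac{\partial F^2}{\partial x^j}\Big),\qquad G^j_i=\frac{\partial G^j}{\partial y^i},\qquad \delta y^i=dy^i+G^i_j\,dx^j,$$ and let $G=g_{ij}\,dx^i\otimes dx^j+g_{ij}\,\delta y^i\otimes\delta y^j$ be the lifted Sasaki metric, a Riemannian metric on $TM\setminus 0$ with Levi-Civita connection $\nabla$. Let $V'TM$ be the $G$-orthogonal complement of the Liouville field $L=y^i\,\partial/\partial y^i$ in the vertical distribution $VTM=\langle\partial/\partial y^1,\dots,\partial/\partial y^n\rangle$. The metric $G$ is called bundle-like for a foliation, given by an involutive distribution $\mathcal D$, if $G(\nabla_XY+\nabla_YX,Z)=0$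 for all smooth local vector fields $X,Y$ orthogonal to $\mathcal D$ and $Z$ tangent to $\mathcal D$. **Theorem.** The metric $G$ is bundle-like for the foliation $V'TM$ if and only if $F$ is Riemannian, i.e. there is a smooth Riemannian metric $h$ on $M$ with $F(x,y)^2=h_x(y,y)$ for all $(x,y)\in TM$. Equivalently, the Cartan tensor $g_{ijk}=\tfrac12\,\partial g_{ij}/\partial y^k$ vanishes on $TM\setminus 0$. -/

import Mathlib

open scoped Manifold ContDiff Topology

noncomputable section

/-! ### Riemannian geometry on an open subset of a vector space

A metric on an open set of `W` (typically a coordinate domain) is a field of bilinear forms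
`G : W → W →L[ℝ] W →L[ℝ] ℝ`. -/

section LocalGeometry

variable {W : Type*} [NormedAddCommGroup W] [NormedSpace ℝ W]

/-- The Christoffel symbols of the first kind of `G` at `q`: the covector
`z ↦ ½ (∂_u G(v, z) + ∂_v G(u, z) - ∂_z G(u, v))`. -/
def christoffelFirst (G : W → W →L[ℝ] W →L[ℝ] ℝ) (q u v : W) : W →L[ℝ] ℝ :=
  (1 / 2 : ℝ) • (fderiv ℝ G q u v + fderiv ℝ G q v u
    - ((fderiv ℝ G q).flip u).flip v)

/-- The Levi-Civita covariant derivative `∇_X Y` of the metric `G` at the point `q`: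
`(∇_X Y)^k = X^i ∂_i Y^k + Γ^k_{ij} X^i Y^j`, where the index of the Christoffel symbols of the
first kind is raised by the inverse of `G q : W → W*`. -/
def leviCivita (G : W → W →L[ℝ] W →L[ℝ] ℝ) (X Y : W → W) (q : W) : W :=
  fderiv ℝ Y q (X q) + (G q).inverse (christoffelFirst G q (X q) (Y q))

/-- The distribution `D` is involutive on `Ω` (so it is tangent to a foliation): the Lie bracket
of two smooth local sections of `D` is a section of `D`. -/
def IsInvolutiveOn (D : W → Submodule ℝ W) (Ω : Set W) : Prop :=
  ∀ U : Set W, IsOpen U → U ⊆ Ω → ∀ X Y : W → W,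
    ContDiffOn ℝ ∞ X U → ContDiffOn ℝ ∞ Y U →
    (∀ q ∈ U, X q ∈ D q) → (∀ q ∈ U, Y q ∈ D q) →
    ∀ q ∈ U, VectorField.lieBracket ℝ X Y q ∈ D q

/-- The metric `G` is bundle-like on `Ω` for the foliation given by the distribution `D`:
`D` is involutive, and `G(∇_X Y + ∇_Y X, Z) = 0` for all smooth local vector fields
`X`, `Y` orthogonal to `D` and `Z` tangent to `D`, with `∇` the Levi-Civita connection of `G`. -/
def IsBundleLikeOn (G : W → W →L[ℝ] W →L[ℝ] ℝ) (D : W → Submodule ℝ W) (Ω : Set W) : Prop :=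
  IsInvolutiveOn D Ω ∧
  ∀ U : Set W, IsOpen U → U ⊆ Ω → ∀ X Y Z : W → W,
    ContDiffOn ℝ ∞ X U → ContDiffOn ℝ ∞ Y U → ContDiffOn ℝ ∞ Z U →
    (∀ q ∈ U, ∀ z ∈ D q, G q (X q) z = 0) →
    (∀ q ∈ U, ∀ z ∈ D q, G q (Y q) z = 0) →
    (∀ q ∈ U, Z q ∈ D q) →
    ∀ q ∈ U, G q (leviCivita G X Y q + leviCivita G Y X q) (Z q) = 0

end LocalGeometry

/-! ### The Sasaki metric of a fundamental function in induced coordinates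

Here `f : E × E → ℝ` is the expression of the fundamental function in the coordinates `(x, y)`
on the tangent bundle induced by a chart of the base. -/

section LocalFinsler

variable {E : Type*} [NormedAddCommGroup E] [NormedSpace ℝ E]

/-- `g_{ij}(x, y) = ½ ∂²F² / ∂y^i ∂y^j`. -/
def localFundamentalTensor (f : E × E → ℝ) (q : E × E) : E →L[ℝ] E →L[ℝ] ℝ :=
  (1 / 2 : ℝ) • (fderiv ℝ (fderiv ℝ (fun p => f p ^ 2)) q).bilinearComp
    (ContinuousLinearMap.inr ℝ E E) (ContinuousLinearMap.inr ℝ E E)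

/-- The spray coefficients
`G^i = ¼ g^{ij} (∂²F² / ∂y^j ∂x^k y^k - ∂F² / ∂x^j)`. -/
def localSpray (f : E × E → ℝ) (q : E × E) : E :=
  (1 / 4 : ℝ) • (localFundamentalTensor f q).inverse
    ((fderiv ℝ (fderiv ℝ (fun p => f p ^ 2)) q (q.2, 0)).comp (ContinuousLinearMap.inr ℝ E E)
      - (fderiv ℝ (fun p => f p ^ 2) q).comp (ContinuousLinearMap.inl ℝ E E))

/-- The nonlinear connection coefficients `G_i^j = ∂G^j / ∂y^i`, as the map `e_i ↦ G_i^j e_j`. -/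
def localNonlinearConnection (f : E × E → ℝ) (q : E × E) : E →L[ℝ] E :=
  (fderiv ℝ (localSpray f) q).comp (ContinuousLinearMap.inr ℝ E E)

/-- The vector of one-forms `δy^i = dy^i + G_j^i dx^j`. -/
def localDeltaY (f : E × E → ℝ) (q : E × E) : E × E →L[ℝ] E :=
  ContinuousLinearMap.snd ℝ E E
    + (localNonlinearConnection f q).comp (ContinuousLinearMap.fst ℝ E E)

/-- The lifted Sasaki metric `G = g_{ij} dx^i ⊗ dx^j + g_{ij} δy^i ⊗ δy^j`. -/
def localSasaki (f : E × E → ℝ) (q : E × E) : E × E →L[ℝ] E × E →L[ℝ] ℝ :=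
  (localFundamentalTensor f q).bilinearComp
      (ContinuousLinearMap.fst ℝ E E) (ContinuousLinearMap.fst ℝ E E)
    + (localFundamentalTensor f q).bilinearComp (localDeltaY f q) (localDeltaY f q)

/-- The vertical Liouville vector field `L = y^i ∂ / ∂y^i`. -/
def localLiouville (q : E × E) : E × E := (0, q.2)

/-- The distribution `V'TM`: the orthogonal complement of `L` in the vertical distribution `VTM`
with respect to the Sasaki metric. -/
def localVPrime (f : E × E → ℝ) (q : E × E) : Submodule ℝ (E × E) :=
  LinearMap.ker (ContinuousLinearMap.fst ℝ E E).toLinearMap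
    ⊓ LinearMap.ker (localSasaki f q (localLiouville q)).toLinearMap

end LocalFinsler

/-! ### Finsler manifolds -/

section Finsler

variable (E : Type*) [NormedAddCommGroup E] [NormedSpace ℝ E]
  (M : Type*) [TopologicalSpace M] [ChartedSpace E M] [IsManifold 𝓘(ℝ, E) ∞ M]

/-- A Finsler metric on the smooth manifold `M`: a function `F : TM → [0, ∞)`, smooth off the zero
section, positively homogeneous of degree one, such that the Hessian
`½ ∂²F² / ∂y^i ∂y^j` along the fibres is positive definite off the zero section. -/
structure FinslerMetric where
  toFun : TangentBundle 𝓘(ℝ, E) M → ℝ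
  nonneg : ∀ p, 0 ≤ toFun p
  smooth : ∀ p : TangentBundle 𝓘(ℝ, E) M, p.2 ≠ 0 →
    ContMDiffAt 𝓘(ℝ, E).tangent 𝓘(ℝ, ℝ) ∞ toFun p
  homogeneous : ∀ (x : M) (v : TangentSpace 𝓘(ℝ, E) x) (c : ℝ), 0 < c →
    toFun ⟨x, c • v⟩ = c * toFun ⟨x, v⟩
  posDef : ∀ (x : M) (y w : E), y ≠ 0 → w ≠ 0 →
    0 < ((1 / 2 : ℝ) • fderiv ℝ (fderiv ℝ (fun v : E => toFun ⟨x, v⟩ ^ 2)) y) w w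

end Finsler

namespace FinslerMetric

variable {E : Type*} [NormedAddCommGroup E] [NormedSpace ℝ E]
  {M : Type*} [TopologicalSpace M] [ChartedSpace E M] [IsManifold 𝓘(ℝ, E) ∞ M]

/-- The fundamental tensor `g_{ij} = ½ ∂²F² / ∂y^i ∂y^j` at the tangent vector `y` at `x`, a
bilinear form on the tangent space at `x` (whose underlying vector space is `E`). -/
def fundamentalTensor (F : FinslerMetric E M) (x : M) (y : E) : E →L[ℝ] E →L[ℝ] ℝ :=
  (1 / 2 : ℝ) • fderiv ℝ (fderiv ℝ (fun v : E => F.toFun ⟨x, v⟩ ^ 2)) y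

/-- The Cartan tensor `g_{ijk} = ½ ∂g_{ij} / ∂y^k` at the tangent vector `y` at `x`. -/
def cartanTensor (F : FinslerMetric E M) (x : M) (y : E) : E →L[ℝ] E →L[ℝ] E →L[ℝ] ℝ :=
  (1 / 2 : ℝ) • fderiv ℝ (F.fundamentalTensor x) y

/-- `F` is Riemannian: it is the norm function of a smooth Riemannian metric on `M`. -/
def IsRiemannian (F : FinslerMetric E M) : Prop :=
  ∃ h : Bundle.ContMDiffRiemannianMetric 𝓘(ℝ, E) ∞ E (fun x : M => TangentSpace 𝓘(ℝ, E) x),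
    ∀ (x : M) (v : TangentSpace 𝓘(ℝ, E) x), F.toFun ⟨x, v⟩ ^ 2 = h.inner x v v

/-- The fundamental function in the coordinates `(x, y)` on the tangent bundle induced by the
chart `e` of `M`; `(x, y)` are the coordinates of the tangent vector `y^i ∂ / ∂x^i` at the point
with coordinates `x`. -/
def inChart (F : FinslerMetric E M) (e : OpenPartialHomeomorph M E) (q : E × E) : ℝ :=
  F.toFun ⟨e.symm q.1, mfderiv 𝓘(ℝ, E) 𝓘(ℝ, E) e.symm q.1 q.2⟩

/-- The lifted Sasaki metric on the tangent bundle without its zero section is bundle-like for the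
foliation `V'TM`, expressed in all induced charts of the tangent bundle. -/
def SasakiIsBundleLikeForVPrime (F : FinslerMetric E M) : Prop :=
  ∀ e ∈ IsManifold.maximalAtlas 𝓘(ℝ, E) ∞ M,
    IsBundleLikeOn (localSasaki (F.inChart e)) (localVPrime (F.inChart e))
      (e.target ×ˢ {y : E | y ≠ 0})

end FinslerMetric

end

/-!
The proof reduces everything to one identity in induced coordinates. Since
`G(∇_X Y + ∇_Y X, Z) = -(𝓛_Z G)(X, Y)` whenever `X`, `Y` are orthogonal to `Z`
(`leviCivita_symm_apply`), being bundle-like for `V'TM` is a statement about the Lie derivative of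
the Sasaki metric along sections of `V'TM`.

Two consequences of the homogeneity of `F` control this Lie derivative. Euler's relation gives
`g_{ij} y^i = ½ ∂F² / ∂y^j`, so `V'TM` consists of the vertical vectors annihilating `F²`: it is
involutive, its leaves are the indicatrices, and its orthogonal complement is spanned by the
Liouville field and the horizontal fields `δ/δx^i = ∂/∂x^i - G_i^j ∂/∂y^j`
(`mem_vPrime`, `orthogonal_vPrime`, `isInvolutiveOn_vPrime`). The definition of the spray gives
`δF²/δx^i = 0` (`fderiv_horizontal`). Together they make all terms involving the derivatives of the
nonlinear connection cancel, and there remains, for `X`, `Y` orthogonal to `V'TM` and `Z` tangent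
to it,

  `G(∇_X Y + ∇_Y X, Z) = -∂g_{ij}/∂y^k X^i Y^j Z^k`   (`sasaki_leviCivita_symm`).

Hence `G` is bundle-like if and only if the Cartan tensor vanishes on triples whose last argument is
tangent to the indicatrix. As the Cartan tensor also vanishes on the Liouville field, this means
that it vanishes identically (`isBundleLikeOn_localSasaki_iff`). It is a tensor
(`fderiv_localFundamentalTensor_inChart`), so the condition does not depend on the chart.

Finally, the Cartan tensor of a quadratic form is zero. Conversely, if the Cartan tensor vanishes
then `g_{ij}(x, ·)` is locally constant on `E ∖ 0`, which is connected in dimension at least two.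
Its value is the required Riemannian metric: `F² = g_{ij} y^i y^j` by Euler's relation, and it is
smooth in `x` because in a chart it may be evaluated at a fixed `y`.
-/

/-! ### Finsler functions on coordinate domains -/

section LocalFinsler

variable {E : Type*} [NormedAddCommGroup E] [NormedSpace ℝ E]

/-- `f` is the expression of a Finsler metric in the coordinates `(x, y)` of `Ω × E`. Only the
square `f ^ 2` is required to be smooth. -/
structure IsLocalFinsler (f : E × E → ℝ) (Ω : Set E) : Prop where
  isOpen : IsOpen Ω
  contDiffOn : ContDiffOn ℝ ∞ (fun p => f p ^ 2) (Ω ×ˢ {y : E | y ≠ 0})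
  homogeneous : ∀ x ∈ Ω, ∀ y : E, ∀ c : ℝ, 0 < c → f (x, c • y) = c * f (x, y)
  posDef : ∀ q ∈ Ω ×ˢ {y : E | y ≠ 0}, ∀ w : E, w ≠ 0 → 0 < localFundamentalTensor f q w w

/-- Product rule for a bilinear form evaluated at two vector fields. -/
lemma fderiv_bilin_apply {W V : Type*} [NormedAddCommGroup W] [NormedSpace ℝ W]
    [NormedAddCommGroup V] [NormedSpace ℝ V]
    {B : W → V →L[ℝ] V →L[ℝ] ℝ} {a b : W → V} {q : W} (hB : DifferentiableAt ℝ B q)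
    (ha : DifferentiableAt ℝ a q) (hb : DifferentiableAt ℝ b q) (w : W) :
    fderiv ℝ (fun p => B p (a p) (b p)) q w
      = fderiv ℝ B q w (a q) (b q) + B q (fderiv ℝ a q w) (b q) + B q (a q) (fderiv ℝ b q w) := by
  rw [fderiv_clm_apply (hB.clm_apply ha) hb, fderiv_clm_apply hB ha]
  simp only [add_apply, ContinuousLinearMap.comp_apply,
    ContinuousLinearMap.flip_apply]
  ring

lemma minSmoothness_two_le_infty : minSmoothness ℝ 2 ≤ (∞ : WithTop ℕ∞) := by
  rw [minSmoothness_of_isRCLikeNormedField]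
  exact WithTop.coe_le_coe.2 le_top

lemma localFundamentalTensor_apply (f : E × E → ℝ) (q : E × E) (v w : E) :
    localFundamentalTensor f q v w
      = (1 / 2 : ℝ) * fderiv ℝ (fderiv ℝ (fun p => f p ^ 2)) q (0, v) (0, w) := by
  simp [localFundamentalTensor]

lemma localDeltaY_apply (f : E × E → ℝ) (q u : E × E) :
    localDeltaY f q u = u.2 + localNonlinearConnection f q u.1 := by
  simp [localDeltaY]

lemma localSasaki_apply (f : E × E → ℝ) (q u v : E × E) :
    localSasaki f q u v = localFundamentalTensor f q u.1 v.1
      + localFundamentalTensor f q (localDeltaY f q u) (localDeltaY f q v) := by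
  simp [localSasaki]

namespace IsLocalFinsler

variable {f : E × E → ℝ} {Ω : Set E}

lemma isOpen_slit (hf : IsLocalFinsler f Ω) : IsOpen (Ω ×ˢ {y : E | y ≠ 0}) :=
  hf.isOpen.prod isOpen_ne

variable {q : E × E}

lemma contDiffAt_sq (hf : IsLocalFinsler f Ω) (hq : q ∈ Ω ×ˢ {y : E | y ≠ 0}) :
    ContDiffAt ℝ ∞ (fun p => f p ^ 2) q :=
  hf.contDiffOn.contDiffAt (hf.isOpen_slit.mem_nhds hq)

lemma contDiffAt_fderiv (hf : IsLocalFinsler f Ω) (hq : q ∈ Ω ×ˢ {y : E | y ≠ 0}) :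
    ContDiffAt ℝ ∞ (fderiv ℝ (fun p => f p ^ 2)) q :=
  (hf.contDiffAt_sq hq).fderiv_right (by simp)

lemma contDiffAt_fderiv₂ (hf : IsLocalFinsler f Ω) (hq : q ∈ Ω ×ˢ {y : E | y ≠ 0}) :
    ContDiffAt ℝ ∞ (fderiv ℝ (fderiv ℝ (fun p => f p ^ 2))) q :=
  (hf.contDiffAt_fderiv hq).fderiv_right (by simp)

lemma fderiv₂_symm (hf : IsLocalFinsler f Ω) (hq : q ∈ Ω ×ˢ {y : E | y ≠ 0}) (u v : E × E) :
    fderiv ℝ (fderiv ℝ (fun p => f p ^ 2)) q u v = fderiv ℝ (fderiv ℝ (fun p => f p ^ 2)) q v u :=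
  ((hf.contDiffAt_sq hq).isSymmSndFDerivAt minSmoothness_two_le_infty).eq u v

lemma contDiffAt_fundamentalTensor (hf : IsLocalFinsler f Ω)
    (hq : q ∈ Ω ×ˢ {y : E | y ≠ 0}) : ContDiffAt ℝ ∞ (localFundamentalTensor f) q := by
  have h := hf.contDiffAt_fderiv₂ hq
  have h1 : ContDiffAt ℝ ∞ (fun p => ((ContinuousLinearMap.compL ℝ E (E × E) ℝ).flip
      (ContinuousLinearMap.inr ℝ E E)).comp
      ((fderiv ℝ (fderiv ℝ (fun p => f p ^ 2)) p).comp (ContinuousLinearMap.inr ℝ E E))) q :=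
    contDiffAt_const.clm_comp (h.clm_comp contDiffAt_const)
  exact h1.const_smul (1 / 2 : ℝ)

lemma fundamentalTensor_symm (hf : IsLocalFinsler f Ω) (hq : q ∈ Ω ×ˢ {y : E | y ≠ 0}) (v w : E) :
    localFundamentalTensor f q v w = localFundamentalTensor f q w v := by
  rw [localFundamentalTensor_apply, localFundamentalTensor_apply, hf.fderiv₂_symm hq]

/-- Euler's relation for `f ^ 2`, which is homogeneous of degree two in `y`. -/
lemma fderiv_liouville (hf : IsLocalFinsler f Ω) (hq : q ∈ Ω ×ˢ {y : E | y ≠ 0}) :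
    fderiv ℝ (fun p => f p ^ 2) q (0, q.2) = 2 * f q ^ 2 := by
  have hd : DifferentiableAt ℝ (fun p => f p ^ 2) q :=
    (hf.contDiffAt_sq hq).differentiableAt (by simp)
  have hc : HasDerivAt (fun t : ℝ => ((q.1, t • q.2) : E × E)) (0, q.2) 1 := by
    have := (hasDerivAt_id (1 : ℝ)).smul_const q.2
    simpa using (hasDerivAt_const (1 : ℝ) q.1).prodMk this
  have h1 : HasDerivAt (fun t : ℝ => f (q.1, t • q.2) ^ 2)
      (fderiv ℝ (fun p => f p ^ 2) q (0, q.2)) 1 := by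
    have hd' : HasFDerivAt (fun p => f p ^ 2) (fderiv ℝ (fun p => f p ^ 2) q)
        ((q.1, (1 : ℝ) • q.2) : E × E) := by simpa using hd.hasFDerivAt
    exact hd'.comp_hasDerivAt (1 : ℝ) hc
  have h2 : HasDerivAt (fun t : ℝ => t ^ 2 * f q ^ 2) (2 * f q ^ 2) 1 := by
    simpa using (hasDerivAt_pow 2 (1 : ℝ)).mul_const (f q ^ 2)
  refine h1.unique (h2.congr_of_eventuallyEq ?_)
  filter_upwards [lt_mem_nhds (zero_lt_one' ℝ)] with t ht
  rw [hf.homogeneous q.1 hq.1 q.2 t ht, mul_pow]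

/-- The derivative of Euler's relation: `y^j ∂²F² / ∂y^j ∂w + ∂F² / ∂y^j w^j = 2 ∂F² / ∂w`. -/
lemma fderiv₂_liouville (hf : IsLocalFinsler f Ω) (hq : q ∈ Ω ×ˢ {y : E | y ≠ 0}) (w : E × E) :
    fderiv ℝ (fderiv ℝ (fun p => f p ^ 2)) q w (0, q.2) + fderiv ℝ (fun p => f p ^ 2) q (0, w.2)
      = 2 * fderiv ℝ (fun p => f p ^ 2) q w := by
  have he : (fun p => fderiv ℝ (fun p => f p ^ 2) p (0, p.2)) =ᶠ[𝓝 q] fun p => 2 * f p ^ 2 := by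
    filter_upwards [hf.isOpen_slit.mem_nhds hq] with p hp using hf.fderiv_liouville hp
  have h := DFunLike.congr_fun (he.fderiv_eq (𝕜 := ℝ)) w
  have hd : DifferentiableAt ℝ (fun p => f p ^ 2) q :=
    (hf.contDiffAt_sq hq).differentiableAt (by simp)
  have hc : HasFDerivAt (fun p : E × E => ((0, p.2) : E × E))
      ((0 : E × E →L[ℝ] E).prod (ContinuousLinearMap.snd ℝ E E)) q :=
    (hasFDerivAt_const (0 : E) q).prodMk hasFDerivAt_snd
  rw [fderiv_clm_apply (𝕜 := ℝ) ((hf.contDiffAt_fderiv hq).differentiableAt (by simp))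
    hc.differentiableAt, hc.fderiv, fderiv_const_mul hd] at h
  simp only [add_apply, ContinuousLinearMap.comp_apply,
    ContinuousLinearMap.flip_apply, ContinuousLinearMap.prod_apply, zero_apply,
    ContinuousLinearMap.coe_snd', smul_apply, smul_eq_mul] at h
  linarith

/-- `g_{ij} y^i = ½ ∂F² / ∂y^j`. -/
lemma fundamentalTensor_liouville (hf : IsLocalFinsler f Ω) (hq : q ∈ Ω ×ˢ {y : E | y ≠ 0})
    (v : E) : localFundamentalTensor f q q.2 v
      = (1 / 2 : ℝ) * fderiv ℝ (fun p => f p ^ 2) q (0, v) := by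
  have h := hf.fderiv₂_liouville hq (0, v)
  rw [localFundamentalTensor_apply, hf.fderiv₂_symm hq]
  linarith

lemma fundamentalTensor_self (hf : IsLocalFinsler f Ω) (hq : q ∈ Ω ×ˢ {y : E | y ≠ 0}) :
    localFundamentalTensor f q q.2 q.2 = f q ^ 2 := by
  rw [hf.fundamentalTensor_liouville hq, hf.fderiv_liouville hq]; ring

lemma fderiv_fundamentalTensor_apply (hf : IsLocalFinsler f Ω) (hq : q ∈ Ω ×ˢ {y : E | y ≠ 0})
    (u : E × E) (v w : E) : fderiv ℝ (localFundamentalTensor f) q u v w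
      = (1 / 2 : ℝ) * fderiv ℝ (fderiv ℝ (fderiv ℝ (fun p => f p ^ 2))) q u (0, v) (0, w) := by
  have h0 : ∀ w : E, fderiv ℝ (fun _ : E × E => ((0, w) : E × E)) q = 0 := fun w => by simp
  have h := fderiv_bilin_apply (a := fun _ : E × E => v) (b := fun _ : E × E => w)
    ((hf.contDiffAt_fundamentalTensor hq).differentiableAt (by simp)) (by fun_prop) (by fun_prop) u
  have h' := fderiv_bilin_apply (a := fun _ : E × E => ((0, v) : E × E))
    (b := fun _ : E × E => ((0, w) : E × E))
    ((hf.contDiffAt_fderiv₂ hq).differentiableAt (by simp)) (by fun_prop) (by fun_prop) u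
  have hd : DifferentiableAt ℝ
      (fun p => fderiv ℝ (fderiv ℝ (fun p => f p ^ 2)) p (0, v) (0, w)) q :=
    (((hf.contDiffAt_fderiv₂ hq).differentiableAt (by simp)).clm_apply
      (differentiableAt_const _)).clm_apply (differentiableAt_const _)
  simp only [localFundamentalTensor_apply] at h
  rw [fderiv_const_mul hd] at h
  simp only [smul_apply, h', h0, smul_eq_mul, fderiv_fun_const, Pi.zero_apply,
    zero_apply, Prod.mk_zero_zero, map_zero, add_zero, mul_zero] at h
  exact h.symm

/-- The Cartan tensor is symmetric in its first two arguments, being a third derivative. -/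
lemma fderiv_fundamentalTensor_symm (hf : IsLocalFinsler f Ω) (hq : q ∈ Ω ×ˢ {y : E | y ≠ 0})
    (u v w : E) : fderiv ℝ (localFundamentalTensor f) q (0, u) v w
      = fderiv ℝ (localFundamentalTensor f) q (0, v) u w := by
  rw [hf.fderiv_fundamentalTensor_apply hq, hf.fderiv_fundamentalTensor_apply hq,
    ((hf.contDiffAt_fderiv hq).isSymmSndFDerivAt minSmoothness_two_le_infty).eq (0, u) (0, v)]

/-- The Cartan tensor annihilates the Liouville field. -/
lemma fderiv_fundamentalTensor_liouville (hf : IsLocalFinsler f Ω)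
    (hq : q ∈ Ω ×ˢ {y : E | y ≠ 0}) (z v : E) :
    fderiv ℝ (localFundamentalTensor f) q (0, z) q.2 v = 0 := by
  have he : (fun p => localFundamentalTensor f p p.2 v)
      =ᶠ[𝓝 q] fun p => (1 / 2 : ℝ) * fderiv ℝ (fun p => f p ^ 2) p (0, v) := by
    filter_upwards [hf.isOpen_slit.mem_nhds hq] with p hp using hf.fundamentalTensor_liouville hp v
  have h := DFunLike.congr_fun (he.fderiv_eq (𝕜 := ℝ)) (0, z)
  have hd : DifferentiableAt ℝ (fderiv ℝ (fun p => f p ^ 2)) q :=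
    (hf.contDiffAt_fderiv hq).differentiableAt (by simp)
  rw [fderiv_const_mul (hd.clm_apply (differentiableAt_const _)),
    fderiv_clm_apply hd (differentiableAt_const _)] at h
  have h2 := fderiv_bilin_apply (a := fun p : E × E => p.2) (b := fun _ : E × E => v)
    ((hf.contDiffAt_fundamentalTensor hq).differentiableAt (by simp)) (by fun_prop) (by fun_prop)
    (0, z)
  rw [h2] at h
  have h3 : fderiv ℝ (fun p : E × E => p.2) q = ContinuousLinearMap.snd ℝ E E := fderiv_snd
  simp only [h3, fderiv_fun_const, Pi.zero_apply, zero_apply, map_zero,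
    add_zero, ContinuousLinearMap.coe_snd', ContinuousLinearMap.comp_zero, zero_add,
    smul_apply, ContinuousLinearMap.flip_apply, smul_eq_mul] at h
  rw [localFundamentalTensor_apply] at h
  linarith

end IsLocalFinsler
end LocalFinsler

/-! ### The Koszul formula for a metric on an open set -/

section LocalGeometry

variable {W : Type*} [NormedAddCommGroup W] [NormedSpace ℝ W]

lemma ContinuousLinearMap.isInvertible_of_pos {V : Type*} [NormedAddCommGroup V] [NormedSpace ℝ V]
    [FiniteDimensional ℝ V] {B : V →L[ℝ] V →L[ℝ] ℝ} (hB : ∀ v, v ≠ 0 → 0 < B v v) :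
    B.IsInvertible := by
  have hinj : Function.Injective (B : V →ₗ[ℝ] V →L[ℝ] ℝ) := by
    refine (injective_iff_map_eq_zero _).2 fun v hv => ?_
    by_contra hne
    have := hB v hne
    rw [show B v = 0 from hv] at this
    simp at this
  have hdim : Module.finrank ℝ V = Module.finrank ℝ (V →L[ℝ] ℝ) :=
    (Subspace.dual_finrank_eq (K := ℝ) (V := V)).symm.trans
      (LinearMap.toContinuousLinearMap (𝕜 := ℝ) (E := V) (F' := ℝ)).finrank_eq
  exact ⟨(LinearEquiv.ofInjectiveOfFinrankEq _ hinj hdim).toContinuousLinearEquiv, by ext; rfl⟩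

/-- For `X`, `Y` orthogonal to `Z`, the symmetrized covariant derivative satisfies
`G(∇_X Y + ∇_Y X, Z) = -(𝓛_Z G)(X, Y)`, written out in terms of partial derivatives. -/
lemma leviCivita_symm_apply {G : W → W →L[ℝ] W →L[ℝ] ℝ} {X Y Z : W → W} {q : W}
    (hG : DifferentiableAt ℝ G q) (hinv : (G q).IsInvertible)
    (hX : DifferentiableAt ℝ X q) (hY : DifferentiableAt ℝ Y q) (hZ : DifferentiableAt ℝ Z q)
    (hXZ : ∀ᶠ p in 𝓝 q, G p (X p) (Z p) = 0) (hYZ : ∀ᶠ p in 𝓝 q, G p (Y p) (Z p) = 0) :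
    G q (leviCivita G X Y q + leviCivita G Y X q) (Z q)
      = -(G q (Y q) (fderiv ℝ Z q (X q)) + G q (X q) (fderiv ℝ Z q (Y q))
        + (1 / 2 : ℝ) * (fderiv ℝ G q (Z q) (X q) (Y q) + fderiv ℝ G q (Z q) (Y q) (X q))) := by
  have h1 : fderiv ℝ (fun p => G p (X p) (Z p)) q (Y q) = 0 := by
    rw [Filter.EventuallyEq.fderiv_eq (f := fun _ => (0 : ℝ)) hXZ]; simp
  have h2 : fderiv ℝ (fun p => G p (Y p) (Z p)) q (X q) = 0 := by
    rw [Filter.EventuallyEq.fderiv_eq (f := fun _ => (0 : ℝ)) hYZ]; simp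
  rw [fderiv_bilin_apply hG hX hZ] at h1
  rw [fderiv_bilin_apply hG hY hZ] at h2
  simp only [leviCivita, map_add, hinv.self_apply_inverse, add_apply, christoffelFirst,
    smul_apply, sub_apply, ContinuousLinearMap.flip_apply, smul_eq_mul]
  linarith

end LocalGeometry

/-! ### The Sasaki metric and the distribution `V'TM` in coordinates -/

section LocalFinsler

variable {E : Type*} [NormedAddCommGroup E] [NormedSpace ℝ E]

namespace IsLocalFinsler

variable {f : E × E → ℝ} {Ω : Set E} {q : E × E}

lemma fderiv_fundamentalTensor_symm_right (hf : IsLocalFinsler f Ω)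
    (hq : q ∈ Ω ×ˢ {y : E | y ≠ 0}) (u : E × E) (v w : E) :
    fderiv ℝ (localFundamentalTensor f) q u v w
      = fderiv ℝ (localFundamentalTensor f) q u w v := by
  have he : (fun p => localFundamentalTensor f p v w)
      =ᶠ[𝓝 q] fun p => localFundamentalTensor f p w v := by
    filter_upwards [hf.isOpen_slit.mem_nhds hq] with p hp using hf.fundamentalTensor_symm hp v w
  have h := DFunLike.congr_fun (he.fderiv_eq (𝕜 := ℝ)) u
  have hd := (hf.contDiffAt_fundamentalTensor hq).differentiableAt (by simp)
  rw [fderiv_bilin_apply hd (by fun_prop) (by fun_prop),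
    fderiv_bilin_apply hd (by fun_prop) (by fun_prop)] at h
  simpa using h

/-- The leaves of `V'TM` are the indicatrices: a vector is tangent to `V'TM` exactly when it is
vertical and annihilates `F ^ 2`. -/
lemma mem_vPrime (hf : IsLocalFinsler f Ω) (hq : q ∈ Ω ×ˢ {y : E | y ≠ 0}) {z : E × E} :
    z ∈ localVPrime f q ↔ z.1 = 0 ∧ fderiv ℝ (fun p => f p ^ 2) q z = 0 := by
  change z.1 = 0 ∧ localSasaki f q (localLiouville q) z = 0 ↔ _
  refine and_congr_right fun hz => ?_
  obtain ⟨z1, z2⟩ := z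
  obtain rfl : z1 = 0 := hz
  simp [localSasaki_apply, localDeltaY_apply, localLiouville, hf.fundamentalTensor_liouville hq]

/-- The vectors orthogonal to `V'TM` are those whose vertical part `δy` is radial. -/
lemma orthogonal_vPrime (hf : IsLocalFinsler f Ω) (hq : q ∈ Ω ×ˢ {y : E | y ≠ 0}) {u : E × E} :
    (∀ z ∈ localVPrime f q, localSasaki f q u z = 0) ↔ ∃ α : ℝ, localDeltaY f q u = α • q.2 := by
  have key : ∀ z : E × E, z.1 = 0 → localSasaki f q u z
      = localFundamentalTensor f q (localDeltaY f q u) z.2 := by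
    intro z hz
    have : localDeltaY f q z = z.2 := by simp [localDeltaY_apply, hz]
    rw [localSasaki_apply, hz, this]; simp
  constructor
  · intro h
    set v := localDeltaY f q u with hv
    have hyy := hf.posDef q hq q.2 hq.2
    set α := localFundamentalTensor f q q.2 v / localFundamentalTensor f q q.2 q.2
    have hyz : localFundamentalTensor f q q.2 (v - α • q.2) = 0 := by
      simp only [map_sub, map_smul, smul_eq_mul, α]
      field_simp
      ring
    refine ⟨α, ?_⟩
    by_contra hne
    have hpos := hf.posDef q hq _ (sub_ne_zero.2 hne)
    have hvz := h (0, v - α • q.2) ((hf.mem_vPrime hq).2 ⟨rfl, by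
      have := hf.fundamentalTensor_liouville hq (v - α • q.2)
      linarith⟩)
    rw [key _ rfl] at hvz
    have hexp : ∀ w, localFundamentalTensor f q (v - α • q.2) w
        = localFundamentalTensor f q v w - α * localFundamentalTensor f q q.2 w := by
      intro w; simp
    rw [hexp, hvz, hyz] at hpos
    simp at hpos
  · rintro ⟨α, hα⟩ z hz
    obtain ⟨hz1, hz2⟩ := (hf.mem_vPrime hq).1 hz
    rw [key z hz1, hα, map_smul, smul_apply, hf.fundamentalTensor_liouville hq, ← hz1,
      Prod.mk.eta, hz2]
    simp

/-- Differentiating the equations `Z^i = 0` and `Z(F²) = 0` which say that `Z` is a section of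
`V'TM`. -/
lemma fderiv_section_vPrime (hf : IsLocalFinsler f Ω) {U : Set (E × E)} (hU : IsOpen U)
    (hUS : U ⊆ Ω ×ˢ {y : E | y ≠ 0}) {Z : E × E → E × E} (hZ : ContDiffOn ℝ ∞ Z U)
    (hZD : ∀ q ∈ U, Z q ∈ localVPrime f q) (hq : q ∈ U) (w : E × E) :
    (fderiv ℝ Z q w).1 = 0 ∧ fderiv ℝ (fderiv ℝ (fun p => f p ^ 2)) q w (Z q)
      + fderiv ℝ (fun p => f p ^ 2) q (fderiv ℝ Z q w) = 0 := by
  have hL : DifferentiableAt ℝ (fderiv ℝ (fun p => f p ^ 2)) q :=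
    (hf.contDiffAt_fderiv (hUS hq)).differentiableAt (by simp)
  have hd : DifferentiableAt ℝ Z q := (hZ.contDiffAt (hU.mem_nhds hq)).differentiableAt (by simp)
  have e1 : (fun p => (Z p).1) =ᶠ[𝓝 q] fun _ => 0 := by
    filter_upwards [hU.mem_nhds hq] with p hp using ((hf.mem_vPrime (hUS hp)).1 (hZD p hp)).1
  have e2 : (fun p => fderiv ℝ (fun p => f p ^ 2) p (Z p)) =ᶠ[𝓝 q] fun _ => 0 := by
    filter_upwards [hU.mem_nhds hq] with p hp using ((hf.mem_vPrime (hUS hp)).1 (hZD p hp)).2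
  have h1 := DFunLike.congr_fun (e1.fderiv_eq (𝕜 := ℝ)) w
  have h2 := DFunLike.congr_fun (e2.fderiv_eq (𝕜 := ℝ)) w
  rw [fderiv_clm_apply hL hd] at h2
  rw [hd.hasFDerivAt.fst.fderiv] at h1
  refine ⟨by simpa using h1, ?_⟩
  simp only [add_apply, ContinuousLinearMap.comp_apply, ContinuousLinearMap.flip_apply,
    fderiv_fun_const, Pi.zero_apply, zero_apply] at h2
  linarith

/-- `V'TM` is involutive, as it is cut out by the exact forms `dx^i` and `d(F²)`. -/
lemma isInvolutiveOn_vPrime (hf : IsLocalFinsler f Ω) :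
    IsInvolutiveOn (localVPrime f) (Ω ×ˢ {y : E | y ≠ 0}) := by
  intro U hU hUS X Y hX hY hXD hYD q hq
  have hx := hf.fderiv_section_vPrime hU hUS hX hXD hq (Y q)
  have hy := hf.fderiv_section_vPrime hU hUS hY hYD hq (X q)
  rw [hf.mem_vPrime (hUS hq), VectorField.lieBracket, Prod.fst_sub, hx.1, hy.1, map_sub]
  have := hf.fderiv₂_symm (hUS hq) (X q) (Y q)
  exact ⟨sub_zero _, by linarith [hx.2, hy.2]⟩

variable [FiniteDimensional ℝ E]

lemma isInvertible_fundamentalTensor (hf : IsLocalFinsler f Ω) (hq : q ∈ Ω ×ˢ {y : E | y ≠ 0}) :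
    (localFundamentalTensor f q).IsInvertible :=
  ContinuousLinearMap.isInvertible_of_pos (hf.posDef q hq)

lemma contDiffAt_spray (hf : IsLocalFinsler f Ω) (hq : q ∈ Ω ×ˢ {y : E | y ≠ 0}) :
    ContDiffAt ℝ ∞ (localSpray f) q := by
  have : CompleteSpace E := FiniteDimensional.complete ℝ E
  have h1 : ContDiffAt ℝ ∞ (fun p => (localFundamentalTensor f p).inverse) q :=
    (hf.isInvertible_fundamentalTensor hq).contDiffAt_map_inverse.comp q
      (hf.contDiffAt_fundamentalTensor hq)
  have h2 : ContDiffAt ℝ ∞ (fun p : E × E => ((p.2, 0) : E × E)) q := by fun_prop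
  have h3 := ((hf.contDiffAt_fderiv₂ hq).clm_apply h2).clm_comp
    (contDiffAt_const (c := ContinuousLinearMap.inr ℝ E E))
  have h4 := (hf.contDiffAt_fderiv hq).clm_comp
    (contDiffAt_const (c := ContinuousLinearMap.inl ℝ E E))
  exact (h1.clm_apply (h3.sub h4)).const_smul (1 / 4 : ℝ)

lemma contDiffAt_nonlinearConnection (hf : IsLocalFinsler f Ω)
    (hq : q ∈ Ω ×ˢ {y : E | y ≠ 0}) : ContDiffAt ℝ ∞ (localNonlinearConnection f) q :=
  ((hf.contDiffAt_spray hq).fderiv_right (by simp)).clm_comp contDiffAt_const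

lemma contDiffAt_sasaki (hf : IsLocalFinsler f Ω) (hq : q ∈ Ω ×ˢ {y : E | y ≠ 0}) :
    ContDiffAt ℝ ∞ (localSasaki f) q := by
  have hg := hf.contDiffAt_fundamentalTensor hq
  have hδ : ContDiffAt ℝ ∞ (localDeltaY f) q :=
    contDiffAt_const.add ((hf.contDiffAt_nonlinearConnection hq).clm_comp contDiffAt_const)
  have key : ∀ A : E × E → E × E →L[ℝ] E, ContDiffAt ℝ ∞ A q →
      ContDiffAt ℝ ∞ (fun p => (localFundamentalTensor f p).bilinearComp (A p) (A p)) q := by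
    intro A hA
    have h1 : ContDiffAt ℝ ∞ (fun p => (ContinuousLinearMap.compL ℝ (E × E) E ℝ).flip (A p)) q :=
      contDiffAt_const.clm_apply hA
    exact h1.clm_comp (hg.clm_comp hA)
  exact (key _ contDiffAt_const).add (key _ hδ)

lemma isInvertible_sasaki (hf : IsLocalFinsler f Ω) (hq : q ∈ Ω ×ˢ {y : E | y ≠ 0}) :
    (localSasaki f q).IsInvertible := by
  have hnn : ∀ w : E, 0 ≤ localFundamentalTensor f q w w := fun w => by
    rcases eq_or_ne w 0 with rfl | hw
    · simp
    · exact (hf.posDef q hq w hw).le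
  refine ContinuousLinearMap.isInvertible_of_pos fun v hv => ?_
  rw [localSasaki_apply]
  by_cases h1 : v.1 = 0
  · have h2 : v.2 ≠ 0 := fun h => hv (Prod.ext h1 h)
    have := hf.posDef q hq _ h2
    simpa [localDeltaY_apply, h1] using this
  · exact add_pos_of_pos_of_nonneg (hf.posDef q hq _ h1) (hnn _)

lemma fundamentalTensor_spray (hf : IsLocalFinsler f Ω) (hq : q ∈ Ω ×ˢ {y : E | y ≠ 0}) (w : E) :
    localFundamentalTensor f q (localSpray f q) w
      = (1 / 4 : ℝ) * (fderiv ℝ (fderiv ℝ (fun p => f p ^ 2)) q (q.2, 0) (0, w)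
        - fderiv ℝ (fun p => f p ^ 2) q (w, 0)) := by
  simp [localSpray, (hf.isInvertible_fundamentalTensor hq).self_apply_inverse]

/-- The spray is tangent to the level sets of `F`: `2 G^i ∂F² / ∂y^i = y^k ∂F² / ∂x^k`. -/
lemma fderiv_spray (hf : IsLocalFinsler f Ω) (hq : q ∈ Ω ×ˢ {y : E | y ≠ 0}) :
    2 * fderiv ℝ (fun p => f p ^ 2) q (0, localSpray f q)
      = fderiv ℝ (fun p => f p ^ 2) q (q.2, 0) := by
  have h1 := hf.fundamentalTensor_spray hq q.2
  have h2 := hf.fderiv₂_liouville hq (q.2, 0)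
  rw [hf.fundamentalTensor_symm hq, hf.fundamentalTensor_liouville hq] at h1
  simp only [Prod.mk_zero_zero, map_zero, add_zero] at h2
  linarith

/-- `F` is constant along the horizontal directions `δ/δx^i = ∂/∂x^i - G_i^j ∂/∂y^j`. -/
lemma fderiv_horizontal (hf : IsLocalFinsler f Ω) (hq : q ∈ Ω ×ˢ {y : E | y ≠ 0}) (u : E) :
    fderiv ℝ (fun p => f p ^ 2) q (u, -localNonlinearConnection f q u) = 0 := by
  have he : (fun p => 2 * fderiv ℝ (fun p => f p ^ 2) p (0, localSpray f p))
      =ᶠ[𝓝 q] fun p => fderiv ℝ (fun p => f p ^ 2) p (p.2, 0) := by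
    filter_upwards [hf.isOpen_slit.mem_nhds hq] with p hp using hf.fderiv_spray hp
  have h := DFunLike.congr_fun (he.fderiv_eq (𝕜 := ℝ)) (0, u)
  have hd : DifferentiableAt ℝ (fderiv ℝ (fun p => f p ^ 2)) q :=
    (hf.contDiffAt_fderiv hq).differentiableAt (by simp)
  have hs : DifferentiableAt ℝ (localSpray f) q :=
    (hf.contDiffAt_spray hq).differentiableAt (by simp)
  have hc1 : HasFDerivAt (fun p : E × E => ((0, localSpray f p) : E × E))
      ((0 : E × E →L[ℝ] E).prod (fderiv ℝ (localSpray f) q)) q :=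
    (hasFDerivAt_const (0 : E) q).prodMk hs.hasFDerivAt
  have hc2 : HasFDerivAt (fun p : E × E => ((p.2, 0) : E × E))
      ((ContinuousLinearMap.snd ℝ E E).prod 0) q :=
    hasFDerivAt_snd.prodMk (hasFDerivAt_const (0 : E) q)
  rw [fderiv_const_mul (hd.clm_apply hc1.differentiableAt),
    fderiv_clm_apply hd hc1.differentiableAt,
    fderiv_clm_apply hd hc2.differentiableAt, hc1.fderiv, hc2.fderiv] at h
  simp only [add_apply, ContinuousLinearMap.comp_apply, ContinuousLinearMap.flip_apply,
    ContinuousLinearMap.prod_apply, zero_apply, ContinuousLinearMap.coe_snd',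
    smul_apply, smul_eq_mul] at h
  have h2 := hf.fundamentalTensor_spray hq u
  rw [hf.fundamentalTensor_symm hq, localFundamentalTensor_apply] at h2
  have hN : localNonlinearConnection f q u = fderiv ℝ (localSpray f) q (0, u) := by
    simp [localNonlinearConnection]
  have h3 := hf.fderiv₂_symm hq (q.2, 0) (0, u)
  have h4 : fderiv ℝ (fun p => f p ^ 2) q (u, -localNonlinearConnection f q u)
      = fderiv ℝ (fun p => f p ^ 2) q (u, 0)
        - fderiv ℝ (fun p => f p ^ 2) q (0, localNonlinearConnection f q u) := by
    rw [← map_sub]; simp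
  rw [h4, hN]
  linarith

/-- The derivative of the Sasaki metric, with its two arguments kept constant. -/
lemma fderiv_sasaki_apply (hf : IsLocalFinsler f Ω) (hq : q ∈ Ω ×ˢ {y : E | y ≠ 0})
    (w u v : E × E) : fderiv ℝ (localSasaki f) q w u v
      = fderiv ℝ (localFundamentalTensor f) q w u.1 v.1
        + fderiv ℝ (localFundamentalTensor f) q w (localDeltaY f q u) (localDeltaY f q v)
        + localFundamentalTensor f q (fderiv ℝ (localNonlinearConnection f) q w u.1)
            (localDeltaY f q v)
        + localFundamentalTensor f q (localDeltaY f q u)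
            (fderiv ℝ (localNonlinearConnection f) q w v.1) := by
  have hg : DifferentiableAt ℝ (localFundamentalTensor f) q :=
    (hf.contDiffAt_fundamentalTensor hq).differentiableAt (by simp)
  have hN : DifferentiableAt ℝ (localNonlinearConnection f) q :=
    (hf.contDiffAt_nonlinearConnection hq).differentiableAt (by simp)
  have hδ : ∀ u : E × E, HasFDerivAt (fun p => localDeltaY f p u)
      ((fderiv ℝ (localNonlinearConnection f) q).flip u.1) q := by
    intro u
    simp only [localDeltaY_apply]
    simpa using (hN.hasFDerivAt.clm_apply (hasFDerivAt_const u.1 q)).const_add u.2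
  have h := fderiv_bilin_apply (a := fun _ : E × E => u) (b := fun _ : E × E => v)
    ((hf.contDiffAt_sasaki hq).differentiableAt (by simp)) (by fun_prop) (by fun_prop) w
  have h1 := fderiv_bilin_apply (a := fun _ : E × E => u.1) (b := fun _ : E × E => v.1)
    hg (by fun_prop) (by fun_prop) w
  have h2 := fderiv_bilin_apply hg (hδ u).differentiableAt (hδ v).differentiableAt w
  simp only [localSasaki_apply] at h
  rw [fderiv_fun_add
    ((hg.clm_apply (differentiableAt_const _)).clm_apply (differentiableAt_const _))
    ((hg.clm_apply (hδ u).differentiableAt).clm_apply (hδ v).differentiableAt),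
    add_apply, h1, h2, (hδ u).fderiv, (hδ v).fderiv] at h
  simp only [fderiv_fun_const, Pi.zero_apply, zero_apply, map_zero, add_zero,
    ContinuousLinearMap.flip_apply, Prod.fst_zero] at h
  linarith

/-- The obstruction to `V'TM` being bundle-like is the Cartan tensor: for `X`, `Y` orthogonal to
`V'TM` and `Z` tangent to it, `G(∇_X Y + ∇_Y X, Z) = -Z(g_{ij}) X^i Y^j`, where `X^i`, `Y^j` are
the horizontal components. -/
lemma sasaki_leviCivita_symm (hf : IsLocalFinsler f Ω) {U : Set (E × E)} (hU : IsOpen U)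
    (hUS : U ⊆ Ω ×ˢ {y : E | y ≠ 0}) {X Y Z : E × E → E × E} (hX : ContDiffOn ℝ ∞ X U)
    (hY : ContDiffOn ℝ ∞ Y U) (hZ : ContDiffOn ℝ ∞ Z U)
    (hXD : ∀ q ∈ U, ∀ z ∈ localVPrime f q, localSasaki f q (X q) z = 0)
    (hYD : ∀ q ∈ U, ∀ z ∈ localVPrime f q, localSasaki f q (Y q) z = 0)
    (hZD : ∀ q ∈ U, Z q ∈ localVPrime f q) (hq : q ∈ U) :
    localSasaki f q (leviCivita (localSasaki f) X Y q + leviCivita (localSasaki f) Y X q) (Z q)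
      = -fderiv ℝ (localFundamentalTensor f) q (Z q) (X q).1 (Y q).1 := by
  have hqS := hUS hq
  have hL : DifferentiableAt ℝ (fderiv ℝ (fun p => f p ^ 2)) q :=
    (hf.contDiffAt_fderiv hqS).differentiableAt (by simp)
  have hN : DifferentiableAt ℝ (localNonlinearConnection f) q :=
    (hf.contDiffAt_nonlinearConnection hqS).differentiableAt (by simp)
  have hd : ∀ V : E × E → E × E, ContDiffOn ℝ ∞ V U → DifferentiableAt ℝ V q := fun V hV =>
    (hV.contDiffAt (hU.mem_nhds hq)).differentiableAt (by simp)
  obtain ⟨hz1, hz2⟩ := (hf.mem_vPrime hqS).1 (hZD q hq)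
  have hzeta : Z q = (0, (Z q).2) := Prod.ext hz1 rfl
  have hgz : fderiv ℝ (fun p => f p ^ 2) q (0, (Z q).2) = 0 := hzeta ▸ hz2
  have key : ∀ w, (fderiv ℝ Z q w).1 = 0 ∧ fderiv ℝ (fun p => f p ^ 2) q (0, (fderiv ℝ Z q w).2)
      = -fderiv ℝ (fderiv ℝ (fun p => f p ^ 2)) q w (Z q) := by
    intro w
    obtain ⟨h1, h2⟩ := hf.fderiv_section_vPrime hU hUS hZ hZD hq w
    rw [show fderiv ℝ Z q w = (0, (fderiv ℝ Z q w).2) from Prod.ext h1 rfl] at h2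
    exact ⟨h1, by linarith⟩
  -- Differentiating `δF²/δx^i = 0` along `Z`.
  have hor : ∀ a : E, fderiv ℝ (fderiv ℝ (fun p => f p ^ 2)) q (a, -localNonlinearConnection f q a)
      (Z q) = fderiv ℝ (fun p => f p ^ 2) q
        (0, fderiv ℝ (localNonlinearConnection f) q (Z q) a) := by
    intro a
    have e : (fun p => fderiv ℝ (fun p => f p ^ 2) p (a, -localNonlinearConnection f p a))
        =ᶠ[𝓝 q] fun _ => 0 := by
      filter_upwards [hf.isOpen_slit.mem_nhds hqS] with p hp using hf.fderiv_horizontal hp a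
    have hc : HasFDerivAt (fun p => ((a, -localNonlinearConnection f p a) : E × E))
        ((0 : E × E →L[ℝ] E).prod (-(fderiv ℝ (localNonlinearConnection f) q).flip a)) q := by
      have := (hN.hasFDerivAt.clm_apply (hasFDerivAt_const a q)).neg
      simp only [ContinuousLinearMap.comp_zero, zero_add] at this
      exact (hasFDerivAt_const a q).prodMk this
    have h := DFunLike.congr_fun (e.fderiv_eq (𝕜 := ℝ)) (Z q)
    rw [fderiv_clm_apply hL hc.differentiableAt, hc.fderiv] at h
    simp only [add_apply, ContinuousLinearMap.comp_apply, ContinuousLinearMap.flip_apply,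
      fderiv_fun_const, Pi.zero_apply, zero_apply, ContinuousLinearMap.prod_apply,
      neg_apply] at h
    rw [hf.fderiv₂_symm hqS]
    have : fderiv ℝ (fun p => f p ^ 2) q
        (0, -fderiv ℝ (localNonlinearConnection f) q (Z q) a)
        = -fderiv ℝ (fun p => f p ^ 2) q
        (0, fderiv ℝ (localNonlinearConnection f) q (Z q) a) := by
      simpa using map_neg (fderiv ℝ (fun p => f p ^ 2) q)
        (0, fderiv ℝ (localNonlinearConnection f) q (Z q) a)
    linarith
  -- The terms `G(Y, D_X Z)` of the Lie derivative.
  have cross : ∀ V V' : E × E, ∀ α β : ℝ, localDeltaY f q V = α • q.2 →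
      localDeltaY f q V' = β • q.2 → localSasaki f q V' (fderiv ℝ Z q V)
        = -(β * localFundamentalTensor f q q.2
          (fderiv ℝ (localNonlinearConnection f) q (Z q) V.1)) := by
    intro V V' α β hV hV'
    obtain ⟨k1, k2⟩ := key V
    have hδ : localDeltaY f q (fderiv ℝ Z q V) = (fderiv ℝ Z q V).2 := by
      simp [localDeltaY_apply, k1]
    have hVd : V = (V.1, -localNonlinearConnection f q V.1) + α • ((0, q.2) : E × E) := by
      rw [localDeltaY_apply] at hV
      refine Prod.ext (by simp) ?_
      simp [← hV]
    have hyz : fderiv ℝ (fderiv ℝ (fun p => f p ^ 2)) q (0, q.2) (Z q) = 0 := by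
      have h := hf.fundamentalTensor_liouville hqS (Z q).2
      rw [localFundamentalTensor_apply, hgz, ← hzeta] at h
      linarith
    have hVZ : fderiv ℝ (fderiv ℝ (fun p => f p ^ 2)) q V (Z q)
        = fderiv ℝ (fun p => f p ^ 2) q
          (0, fderiv ℝ (localNonlinearConnection f) q (Z q) V.1) := by
      conv_lhs => rw [hVd]
      rw [map_add, add_apply, hor, map_smul, smul_apply, hyz, smul_zero, add_zero]
    rw [localSasaki_apply, k1, hδ, hV', map_zero, zero_add, map_smul, smul_apply,
      hf.fundamentalTensor_liouville hqS, k2, hVZ, hf.fundamentalTensor_liouville hqS, smul_eq_mul]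
    ring
  obtain ⟨α, hα⟩ := (hf.orthogonal_vPrime hqS).1 (hXD q hq)
  obtain ⟨β, hβ⟩ := (hf.orthogonal_vPrime hqS).1 (hYD q hq)
  have hC : fderiv ℝ (localFundamentalTensor f) q (Z q) q.2 q.2 = 0 := by
    rw [hzeta]; exact hf.fderiv_fundamentalTensor_liouville hqS _ _
  have hsymm := hf.fderiv_fundamentalTensor_symm_right hqS (Z q) (X q).1 (Y q).1
  have hs1 := hf.fundamentalTensor_symm hqS
    (fderiv ℝ (localNonlinearConnection f) q (Z q) (X q).1) q.2
  have hs2 := hf.fundamentalTensor_symm hqS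
    (fderiv ℝ (localNonlinearConnection f) q (Z q) (Y q).1) q.2
  rw [leviCivita_symm_apply ((hf.contDiffAt_sasaki hqS).differentiableAt (by simp))
    (hf.isInvertible_sasaki hqS) (hd X hX) (hd Y hY) (hd Z hZ)
    (by filter_upwards [hU.mem_nhds hq] with p hp using hXD p hp _ (hZD p hp))
    (by filter_upwards [hU.mem_nhds hq] with p hp using hYD p hp _ (hZD p hp)),
    cross _ _ α β hα hβ, cross _ _ β α hβ hα, hf.fderiv_sasaki_apply hqS,
    hf.fderiv_sasaki_apply hqS, hα, hβ]
  simp only [map_smul, smul_apply, smul_eq_mul, hC, hs1, hs2, hsymm]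
  ring

end IsLocalFinsler

/-- On a coordinate domain, the Sasaki metric is bundle-like for `V'TM` if and only if the
vertical derivative of the fundamental tensor vanishes. -/
theorem isBundleLikeOn_localSasaki_iff [FiniteDimensional ℝ E] {f : E × E → ℝ} {Ω : Set E}
    (hf : IsLocalFinsler f Ω) :
    IsBundleLikeOn (localSasaki f) (localVPrime f) (Ω ×ˢ {y : E | y ≠ 0}) ↔
      ∀ q ∈ Ω ×ˢ {y : E | y ≠ 0}, ∀ z : E,
        fderiv ℝ (localFundamentalTensor f) q (0, z) = 0 := by
  constructor
  · rintro ⟨-, h⟩ q hq z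
    -- `z` is split into its radial part and a part tangent to the indicatrix, which is extended
    -- to a section of `V'TM` by the same formula at all points.
    let c : E × E → ℝ := fun p =>
      localFundamentalTensor f p p.2 z / localFundamentalTensor f p p.2 p.2
    have hpos : ∀ p ∈ Ω ×ˢ {y : E | y ≠ 0}, localFundamentalTensor f p p.2 p.2 ≠ 0 :=
      fun p hp => (hf.posDef p hp p.2 hp.2).ne'
    have hZD : ∀ p ∈ Ω ×ˢ {y : E | y ≠ 0}, ((0, z - c p • p.2) : E × E) ∈ localVPrime f p := by
      intro p hp
      refine (hf.mem_vPrime hp).2 ⟨rfl, ?_⟩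
      have h1 := hf.fundamentalTensor_liouville hp (z - c p • p.2)
      have h2 : localFundamentalTensor f p p.2 (z - c p • p.2) = 0 := by
        simp only [map_sub, map_smul, smul_eq_mul, c]
        rw [div_mul_cancel₀ _ (hpos p hp), sub_self]
      linarith
    have hZ : ContDiffOn ℝ ∞ (fun p => ((0, z - c p • p.2) : E × E)) (Ω ×ˢ {y : E | y ≠ 0}) := by
      intro p hp
      refine ContDiffAt.contDiffWithinAt ?_
      have hg := hf.contDiffAt_fundamentalTensor hp
      have hc : ContDiffAt ℝ ∞ c p :=
        ((hg.clm_apply contDiffAt_snd).clm_apply contDiffAt_const).div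
          ((hg.clm_apply contDiffAt_snd).clm_apply contDiffAt_snd) (hpos p hp)
      exact contDiffAt_const.prodMk (contDiffAt_const.sub (hc.smul contDiffAt_snd))
    have hHD : ∀ a : E, ∀ p ∈ Ω ×ˢ {y : E | y ≠ 0}, ∀ w ∈ localVPrime f p,
        localSasaki f p (a, -localNonlinearConnection f p a) w = 0 := fun a p hp =>
      (hf.orthogonal_vPrime hp).2 ⟨0, by simp [localDeltaY_apply]⟩
    have hH : ∀ a : E, ContDiffOn ℝ ∞
        (fun p => ((a, -localNonlinearConnection f p a) : E × E)) (Ω ×ˢ {y : E | y ≠ 0}) :=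
      fun a p hp => (contDiffAt_const.prodMk
        ((hf.contDiffAt_nonlinearConnection hp).clm_apply contDiffAt_const).neg).contDiffWithinAt
    ext a b
    have h1 := h _ hf.isOpen_slit le_rfl _ _ _ (hH a) (hH b) hZ (hHD a) (hHD b) hZD q hq
    rw [hf.sasaki_leviCivita_symm hf.isOpen_slit le_rfl (hH a) (hH b) hZ (hHD a) (hHD b) hZD hq,
      neg_eq_zero] at h1
    have h2 : fderiv ℝ (localFundamentalTensor f) q (0, q.2) a b = 0 := by
      rw [hf.fderiv_fundamentalTensor_symm hq]
      exact hf.fderiv_fundamentalTensor_liouville hq a b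
    have h3 : ((0, z) : E × E) = (0, z - c q • q.2) + c q • ((0, q.2) : E × E) := by simp
    rw [h3, map_add, map_smul]
    simp only [add_apply, smul_apply, h2, zero_apply, smul_zero, add_zero]
    exact h1
  · intro h
    refine ⟨hf.isInvolutiveOn_vPrime, fun U hU hUS X Y Z hX hY hZ hXD hYD hZD q hq => ?_⟩
    rw [hf.sasaki_leviCivita_symm hU hUS hX hY hZ hXD hYD hZD hq]
    have hz := ((hf.mem_vPrime (hUS hq)).1 (hZD q hq)).1
    rw [show Z q = (0, (Z q).2) from Prod.ext hz rfl, h q (hUS hq)]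
    simp

end LocalFinsler

/-! ### Induced charts of the tangent bundle -/

section Fiber

variable {E : Type*} [NormedAddCommGroup E] [NormedSpace ℝ E]

lemma fderiv_fderiv_comp_equiv (φ : E → ℝ) (A : E ≃L[ℝ] E) (y v w : E) :
    fderiv ℝ (fderiv ℝ (fun v => φ (A v))) y v w = fderiv ℝ (fderiv ℝ φ) (A y) (A v) (A w) := by
  have h1 : fderiv ℝ (fun v => φ (A v)) = fun y => (fderiv ℝ φ (A y)).comp (A : E →L[ℝ] E) :=
    funext fun y => A.comp_right_fderiv
  let R : (E →L[ℝ] ℝ) ≃L[ℝ] (E →L[ℝ] ℝ) := A.symm.arrowCongr (ContinuousLinearEquiv.refl ℝ ℝ)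
  have h2 : (fun y => (fderiv ℝ φ (A y)).comp (A : E →L[ℝ] E))
      = R ∘ ((fderiv ℝ φ) ∘ A) := by
    funext y; ext v; simp [R, ContinuousLinearEquiv.arrowCongr_apply]
  rw [h1, h2, R.comp_fderiv, A.comp_right_fderiv]
  simp [R]

lemma fderiv_fderiv_slice {L : E × E → ℝ} {x y : E} (hL : ContDiffAt ℝ 2 L (x, y)) (v w : E) :
    fderiv ℝ (fderiv ℝ (fun y => L (x, y))) y v w
      = fderiv ℝ (fderiv ℝ L) (x, y) (0, v) (0, w) := by
  have hι : ∀ y : E, HasFDerivAt (fun y : E => ((x, y) : E × E)) (ContinuousLinearMap.inr ℝ E E) y :=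
    fun y => hasFDerivAt_prodMk_right x y
  have h1 : fderiv ℝ (fun y => L (x, y))
      =ᶠ[𝓝 y] fun y => (fderiv ℝ L (x, y)).comp (ContinuousLinearMap.inr ℝ E E) := by
    have : ∀ᶠ p in 𝓝 (x, y), ContDiffAt ℝ 2 L p := hL.eventually (by simp)
    filter_upwards [(hι y).continuousAt.eventually this] with z hz
    exact ((hz.differentiableAt (by simp)).hasFDerivAt.comp z (hι z)).fderiv
  have hd : DifferentiableAt ℝ (fderiv ℝ L) (x, y) :=
    (hL.fderiv_right (m := 1) (by norm_num)).differentiableAt (by simp)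
  have h2 : HasFDerivAt (fun y => fderiv ℝ L (x, y)) _ y := hd.hasFDerivAt.comp y (hι y)
  rw [h1.fderiv_eq, (h2.clm_comp (hasFDerivAt_const (ContinuousLinearMap.inr ℝ E E) y)).fderiv]
  simp

end Fiber

namespace FinslerMetric

variable {E : Type*} [NormedAddCommGroup E] [NormedSpace ℝ E]
  {M : Type*} [TopologicalSpace M] [ChartedSpace E M] {e : OpenPartialHomeomorph M E}

lemma mdifferentiable_of_mem_maximalAtlas (he : e ∈ IsManifold.maximalAtlas 𝓘(ℝ, E) ∞ M) :
    e.MDifferentiable 𝓘(ℝ, E) 𝓘(ℝ, E) :=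
  ⟨(contMDiffOn_of_mem_maximalAtlas he).mdifferentiableOn (by simp),
    (contMDiffOn_symm_of_mem_maximalAtlas he).mdifferentiableOn (by simp)⟩

/-- The change of fibre coordinates induced by a chart, as an automorphism of the model space `E`
which underlies every tangent space. -/
lemma exists_equiv_mfderiv_symm (he : e ∈ IsManifold.maximalAtlas 𝓘(ℝ, E) ∞ M) {x : E}
    (hx : x ∈ e.target) :
    ∃ A : E ≃L[ℝ] E, ∀ y : E, mfderiv 𝓘(ℝ, E) 𝓘(ℝ, E) e.symm x y = A y :=
  ⟨(mdifferentiable_of_mem_maximalAtlas he).symm.mfderiv hx, fun _ => rfl⟩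

variable [IsManifold 𝓘(ℝ, E) ∞ M] (F : FinslerMetric E M)

/-- `F.inChart e` is `F` composed with the bundled derivative of `e.symm`, which is a smooth map of
tangent bundles. -/
lemma contDiffAt_inChart (he : e ∈ IsManifold.maximalAtlas 𝓘(ℝ, E) ∞ M) {q : E × E}
    (hq : q ∈ e.target ×ˢ {y : E | y ≠ 0}) : ContDiffAt ℝ ∞ (F.inChart e) q := by
  have : IsManifold 𝓘(ℝ, E) 1 M := .of_le (n := ∞) (by simp)
  obtain ⟨A, hA⟩ := exists_equiv_mfderiv_symm he hq.1
  have hs := (contMDiffOn_symm_of_mem_maximalAtlas he).contMDiffOn_tangentMapWithin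
    (m := ∞) (by simp) e.open_target.uniqueMDiffOn
  have hs' : ContMDiffAt 𝓘(ℝ, E).tangent 𝓘(ℝ, E).tangent ∞
      (tangentMapWithin 𝓘(ℝ, E) 𝓘(ℝ, E) e.symm e.target)
      (⟨q.1, q.2⟩ : TangentBundle 𝓘(ℝ, E) E) :=
    hs.contMDiffAt ((e.open_target.preimage (FiberBundle.continuous_proj E _)).mem_nhds hq.1)
  have hmod : ContMDiffAt 𝓘(ℝ, E).tangent 𝓘(ℝ, E).tangent ∞
      ((tangentBundleModelSpaceHomeomorph 𝓘(ℝ, E)).symm : ModelProd E E → TangentBundle 𝓘(ℝ, E) E)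
      q := contMDiff_tangentBundleModelSpaceHomeomorph_symm q
  have hF := F.smooth (tangentMapWithin 𝓘(ℝ, E) 𝓘(ℝ, E) e.symm e.target ⟨q.1, q.2⟩) (by
    have h1 : (tangentMapWithin 𝓘(ℝ, E) 𝓘(ℝ, E) e.symm e.target
        (⟨q.1, q.2⟩ : TangentBundle 𝓘(ℝ, E) E)).2 = A q.2 := by
      rw [← hA, ← mfderivWithin_of_isOpen e.open_target hq.1]; rfl
    rw [h1]
    exact A.map_ne_zero_iff.2 hq.2)
  have hcomp := ContMDiffAt.comp (g := F.toFun ∘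
      tangentMapWithin 𝓘(ℝ, E) 𝓘(ℝ, E) e.symm e.target) (f := (tangentBundleModelSpaceHomeomorph
      𝓘(ℝ, E)).symm) (x := q) (hF.comp (⟨q.1, q.2⟩ : TangentBundle 𝓘(ℝ, E) E) hs') hmod
  have hcd : ContDiffAt ℝ ∞ (fun p : E × E => F.toFun
      (tangentMapWithin 𝓘(ℝ, E) 𝓘(ℝ, E) e.symm e.target (⟨p.1, p.2⟩ : TangentBundle 𝓘(ℝ, E) E)))
      q := by
    rw [← contMDiffAt_iff_contDiffAt, modelWithCornersSelf_prod]
    exact hcomp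
  refine hcd.congr_of_eventuallyEq ?_
  filter_upwards [(e.open_target.prod isOpen_univ).mem_nhds (show q ∈ e.target ×ˢ Set.univ from
    ⟨hq.1, trivial⟩)] with p hp
  simp only [inChart, tangentMapWithin]
  rw [mfderivWithin_of_isOpen e.open_target hp.1]

lemma exists_chart_symm_eq (x : M) : ∃ e ∈ IsManifold.maximalAtlas 𝓘(ℝ, E) ∞ M,
    ∃ x' ∈ e.target, e.symm x' = x :=
  ⟨chartAt E x, IsManifold.chart_mem_maximalAtlas x, chartAt E x x,
    (chartAt E x).map_source (mem_chart_source E x), (chartAt E x).left_inv (mem_chart_source E x)⟩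

variable {F} {x y : E} {A : E ≃L[ℝ] E}

lemma localFundamentalTensor_inChart (he : e ∈ IsManifold.maximalAtlas 𝓘(ℝ, E) ∞ M)
    (hx : x ∈ e.target) (hy : y ≠ 0)
    (hA : ∀ y : E, mfderiv 𝓘(ℝ, E) 𝓘(ℝ, E) e.symm x y = A y) (v w : E) :
    localFundamentalTensor (F.inChart e) (x, y) v w
      = F.fundamentalTensor (e.symm x) (A y) (A v) (A w) := by
  have hL : ContDiffAt ℝ 2 (fun p => F.inChart e p ^ 2) (x, y) :=
    ((F.contDiffAt_inChart he (q := (x, y)) ⟨hx, hy⟩).pow 2).of_le (WithTop.coe_le_coe.2 le_top)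
  have hφ : (fun y => F.inChart e (x, y) ^ 2)
      = fun y => (fun v : E => F.toFun ⟨e.symm x, v⟩ ^ 2) (A y) := by
    funext y
    simp only [inChart]
    rw [hA]
  rw [localFundamentalTensor_apply,
    ← fderiv_fderiv_slice (L := fun p => F.inChart e p ^ 2) hL, hφ]
  exact congrArg ((1 / 2 : ℝ) * ·)
    (fderiv_fderiv_comp_equiv (fun v : E => F.toFun ⟨e.symm x, v⟩ ^ 2) A y v w)

lemma contDiffAt_fundamentalTensor (F : FinslerMetric E M) (x : M) {y : E} (hy : y ≠ 0) :
    ContDiffAt ℝ ∞ (F.fundamentalTensor x) y := by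
  obtain ⟨e, he, x, hx, rfl⟩ := exists_chart_symm_eq (E := E) x
  obtain ⟨A, hA⟩ := exists_equiv_mfderiv_symm he hx
  have hL : ContDiffAt ℝ ∞ (fun p => F.inChart e p ^ 2) (x, A.symm y) :=
    (F.contDiffAt_inChart he (q := (x, A.symm y)) ⟨hx, A.symm.map_ne_zero_iff.2 hy⟩).pow 2
  have hφ : (fun v : E => F.toFun ⟨e.symm x, v⟩ ^ 2)
      = (fun p => F.inChart e p ^ 2) ∘ fun v : E => (x, A.symm v) := by
    funext v
    simp only [inChart, Function.comp]
    rw [hA, A.apply_symm_apply]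
  have h : ContDiffAt ℝ ∞ (fun v : E => F.toFun ⟨e.symm x, v⟩ ^ 2) y := by
    rw [hφ]
    exact hL.comp y (contDiffAt_const.prodMk A.symm.contDiff.contDiffAt)
  exact (((h.fderiv_right (m := ∞) (by simp)).fderiv_right (m := ∞) (by simp))).const_smul
    (1 / 2 : ℝ)

lemma isLocalFinsler_inChart (F : FinslerMetric E M)
    (he : e ∈ IsManifold.maximalAtlas 𝓘(ℝ, E) ∞ M) : IsLocalFinsler (F.inChart e) e.target where
  isOpen := e.open_target
  contDiffOn := fun _ hq => ((F.contDiffAt_inChart he hq).pow 2).contDiffWithinAt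
  homogeneous := by
    intro x hx y c hc
    exact (congrArg (fun w => F.toFun ⟨e.symm x, w⟩)
      (map_smul (mfderiv 𝓘(ℝ, E) 𝓘(ℝ, E) e.symm x) c y)).trans (F.homogeneous _ _ c hc)
  posDef := by
    rintro ⟨x, y⟩ ⟨hx, hy⟩ w hw
    obtain ⟨A, hA⟩ := exists_equiv_mfderiv_symm he hx
    rw [localFundamentalTensor_inChart he hx hy hA]
    exact F.posDef _ _ _ (A.map_ne_zero_iff.2 hy) (A.map_ne_zero_iff.2 hw)

lemma fderiv_localFundamentalTensor_inChart (he : e ∈ IsManifold.maximalAtlas 𝓘(ℝ, E) ∞ M)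
    (hx : x ∈ e.target) (hy : y ≠ 0)
    (hA : ∀ y : E, mfderiv 𝓘(ℝ, E) 𝓘(ℝ, E) e.symm x y = A y) (z v w : E) :
    fderiv ℝ (localFundamentalTensor (F.inChart e)) (x, y) (0, z) v w
      = 2 * F.cartanTensor (e.symm x) (A y) (A z) (A v) (A w) := by
  have hι : HasFDerivAt (fun y : E => ((x, y) : E × E)) (ContinuousLinearMap.inr ℝ E E) y :=
    hasFDerivAt_prodMk_right x y
  have h1 : HasFDerivAt (fun y => localFundamentalTensor (F.inChart e) (x, y)) _ y :=
    (((F.isLocalFinsler_inChart he).contDiffAt_fundamentalTensor (q := (x, y))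
      ⟨hx, hy⟩).differentiableAt (by simp)).hasFDerivAt.comp y hι
  have h2 : HasFDerivAt (fun y => F.fundamentalTensor (e.symm x) (A y)) _ y :=
    ((F.contDiffAt_fundamentalTensor (e.symm x) (A.map_ne_zero_iff.2 hy)).differentiableAt
      (by simp)).hasFDerivAt.comp y A.hasFDerivAt
  have he : (fun y => localFundamentalTensor (F.inChart e) (x, y) v w)
      =ᶠ[𝓝 y] fun y => F.fundamentalTensor (e.symm x) (A y) (A v) (A w) := by
    filter_upwards [isOpen_ne.mem_nhds hy] with y hy
      using localFundamentalTensor_inChart he hx hy hA v w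
  have h := DFunLike.congr_fun (he.fderiv_eq (𝕜 := ℝ)) z
  rw [fderiv_bilin_apply (a := fun _ : E => v) (b := fun _ : E => w) h1.differentiableAt
    (by fun_prop) (by fun_prop),
    fderiv_bilin_apply (a := fun _ : E => A v) (b := fun _ : E => A w) h2.differentiableAt
    (by fun_prop) (by fun_prop), h1.fderiv, h2.fderiv] at h
  simpa [cartanTensor] using h

/-- The Cartan tensor vanishes if and only if its expressions in all induced charts do. -/
lemma cartanTensor_eq_zero_iff (F : FinslerMetric E M) :
    (∀ (x : M) (y : E), y ≠ 0 → F.cartanTensor x y = 0) ↔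
      ∀ e ∈ IsManifold.maximalAtlas 𝓘(ℝ, E) ∞ M, ∀ q ∈ e.target ×ˢ {y : E | y ≠ 0}, ∀ z : E,
        fderiv ℝ (localFundamentalTensor (F.inChart e)) q (0, z) = 0 := by
  constructor
  · rintro h e he ⟨x, y⟩ hq z
    have hx : x ∈ e.target := hq.1
    have hy : y ≠ 0 := hq.2
    obtain ⟨A, hA⟩ := exists_equiv_mfderiv_symm he hx
    ext v w
    rw [fderiv_localFundamentalTensor_inChart he hx hy hA,
      h (e.symm x) (A y) (A.map_ne_zero_iff.2 hy)]
    simp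
  · intro h x y hy
    obtain ⟨e, he, x, hx, rfl⟩ := exists_chart_symm_eq (E := E) x
    obtain ⟨A, hA⟩ := exists_equiv_mfderiv_symm he hx
    have hy' : A.symm y ≠ 0 := A.symm.map_ne_zero_iff.2 hy
    ext z v w
    have h1 := fderiv_localFundamentalTensor_inChart (F := F) he hx hy' hA
      (A.symm z) (A.symm v) (A.symm w)
    rw [h e he (x, A.symm y) ⟨hx, hy'⟩] at h1
    simpa using h1.symm

lemma fundamentalTensor_symm (F : FinslerMetric E M) (x : M) {y : E} (hy : y ≠ 0) (v w : E) :
    F.fundamentalTensor x y v w = F.fundamentalTensor x y w v := by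
  obtain ⟨e, he, x, hx, rfl⟩ := exists_chart_symm_eq (E := E) x
  obtain ⟨A, hA⟩ := exists_equiv_mfderiv_symm he hx
  have hy' : A.symm y ≠ 0 := A.symm.map_ne_zero_iff.2 hy
  have h := (F.isLocalFinsler_inChart he).fundamentalTensor_symm (q := (x, A.symm y)) ⟨hx, hy'⟩
    (A.symm v) (A.symm w)
  rw [localFundamentalTensor_inChart he hx hy' hA, localFundamentalTensor_inChart he hx hy' hA] at h
  simpa using h

lemma fundamentalTensor_self (F : FinslerMetric E M) (x : M) {y : E} (hy : y ≠ 0) :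
    F.fundamentalTensor x y y y = F.toFun ⟨x, y⟩ ^ 2 := by
  obtain ⟨e, he, x, hx, rfl⟩ := exists_chart_symm_eq (E := E) x
  obtain ⟨A, hA⟩ := exists_equiv_mfderiv_symm he hx
  have hy' : A.symm y ≠ 0 := A.symm.map_ne_zero_iff.2 hy
  have h := (F.isLocalFinsler_inChart he).fundamentalTensor_self (q := (x, A.symm y)) ⟨hx, hy'⟩
  rw [localFundamentalTensor_inChart he hx hy' hA, inChart] at h
  rw [hA] at h
  simpa using h

/-- Homogeneity alone makes `F` vanish on the zero section, where it need not be smooth. -/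
lemma toFun_zero (F : FinslerMetric E M) (x : M) :
    F.toFun ⟨x, (0 : TangentSpace 𝓘(ℝ, E) x)⟩ = 0 := by
  have h := F.homogeneous x 0 2 two_pos
  rw [smul_zero] at h
  linarith

/-- The norm function of a Riemannian metric is quadratic on the fibres, so its third vertical
derivative vanishes. -/
lemma cartanTensor_eq_zero_of_isRiemannian (hF : F.IsRiemannian) (x : M) (y : E) :
    F.cartanTensor x y = 0 := by
  obtain ⟨h, hh⟩ := hF
  let B : E →L[ℝ] E →L[ℝ] ℝ := h.inner x
  have h1 : (fun v : E => F.toFun ⟨x, v⟩ ^ 2) = fun v => B v v := funext fun v => hh x v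
  have h2 : fderiv ℝ (fun v => B v v) = fun v => (B + B.flip) v := by
    funext v
    ext w
    rw [fderiv_clm_apply B.differentiableAt differentiableAt_fun_id]
    simp
  have h3 : F.fundamentalTensor x = fun _ => (1 / 2 : ℝ) • (B + B.flip) := by
    funext v
    rw [fundamentalTensor, h1, h2, ContinuousLinearMap.fderiv]
  ext u v w
  change (1 / 2 : ℝ) * fderiv ℝ (F.fundamentalTensor x) y u v w = 0
  rw [h3, fderiv_fun_const]
  simp

end FinslerMetric

/-! ### Vanishing of the Cartan tensor and Riemannian metrics -/

/-- The unit ball of a positive definite form on a finite-dimensional space is bounded, because the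
form is bounded below on the compact unit sphere. -/
lemma isVonNBounded_setOf_lt_one {V : Type*} [NormedAddCommGroup V] [NormedSpace ℝ V]
    [FiniteDimensional ℝ V] [Nontrivial V] {B : V →L[ℝ] V →L[ℝ] ℝ}
    (hB : ∀ v, v ≠ 0 → 0 < B v v) :
    Bornology.IsVonNBounded ℝ {v : V | B v v < 1} := by
  have : ProperSpace V := FiniteDimensional.proper ℝ V
  obtain ⟨u, hu, hmin⟩ := (isCompact_sphere (0 : V) 1).exists_isMinOn
    (NormedSpace.sphere_nonempty.2 zero_le_one)
    (f := fun v => B v v) (by fun_prop)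
  have hu1 : ‖u‖ = 1 := by simpa using hu
  have hpos : 0 < B u u := hB u (norm_ne_zero_iff.1 (by rw [hu1]; exact one_ne_zero))
  have hlow : ∀ v, B u u * ‖v‖ ^ 2 ≤ B v v := by
    intro v
    rcases eq_or_ne v 0 with rfl | hv
    · simp
    have hv' : ‖v‖ ≠ 0 := norm_ne_zero_iff.2 hv
    have h := isMinOn_iff.1 hmin (‖v‖⁻¹ • v) (by simp [norm_smul, hv'])
    simp only [map_smul, smul_apply, smul_eq_mul] at h
    calc B u u * ‖v‖ ^ 2 ≤ ‖v‖⁻¹ * (‖v‖⁻¹ * B v v) * ‖v‖ ^ 2 := by gcongr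
      _ = B v v := by field_simp
  rw [NormedSpace.isVonNBounded_iff, isBounded_iff_forall_norm_le]
  refine ⟨1 + (B u u)⁻¹, fun v hv => ?_⟩
  have h1 : ‖v‖ ^ 2 ≤ (B u u)⁻¹ := by
    rw [← one_div, le_div_iff₀ hpos, mul_comm]
    exact (hlow v).trans (le_of_lt hv)
  nlinarith [sq_nonneg (‖v‖ - 1), norm_nonneg v]

namespace FinslerMetric

variable {E : Type*} [NormedAddCommGroup E] [NormedSpace ℝ E]
  {M : Type*} [TopologicalSpace M] [ChartedSpace E M] [IsManifold 𝓘(ℝ, E) ∞ M]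

/-- Freezing the vertical argument of `g_{ij}` gives a smooth field of bilinear forms as soon as
`g_{ij}` does not depend on it: in a chart around `x₀` the field is then
`x ↦ g_{ij}(x, y₀)` for any fixed nonzero coordinate vector `y₀`. -/
lemma contMDiff_fundamentalTensor (F : FinslerMetric E M) {y₀ : E} (hy₀ : y₀ ≠ 0)
    (hF : ∀ (x : M) (y : E), y ≠ 0 → F.fundamentalTensor x y = F.fundamentalTensor x y₀) :
    ContMDiff 𝓘(ℝ, E) (𝓘(ℝ, E).prod 𝓘(ℝ, E →L[ℝ] E →L[ℝ] ℝ)) ∞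
      (fun x : M => Bundle.TotalSpace.mk' (E →L[ℝ] E →L[ℝ] ℝ)
        (E := fun x : M => TangentSpace 𝓘(ℝ, E) x →L[ℝ] TangentSpace 𝓘(ℝ, E) x →L[ℝ] ℝ) x
        (F.fundamentalTensor x y₀)) := by
  have : IsManifold 𝓘(ℝ, E) 1 M := .of_le (n := ∞) (by simp)
  intro x₀
  rw [contMDiffAt_hom_bundle]
  refine ⟨contMDiffAt_id, ?_⟩
  let e := chartAt E x₀
  have he : e ∈ IsManifold.maximalAtlas 𝓘(ℝ, E) ∞ M := IsManifold.chart_mem_maximalAtlas x₀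
  have hx₀ : x₀ ∈ e.source := mem_chart_source E x₀
  have hg : ContDiffAt ℝ ∞ (fun x : E => localFundamentalTensor (F.inChart e) (x, y₀)) (e x₀) :=
    ContDiffAt.comp (g := localFundamentalTensor (F.inChart e)) (f := fun x : E => (x, y₀)) (e x₀)
      ((F.isLocalFinsler_inChart he).contDiffAt_fundamentalTensor (q := (e x₀, y₀))
        ⟨e.map_source hx₀, hy₀⟩) (contDiffAt_id.prodMk contDiffAt_const)
  have hsm : ContMDiffAt 𝓘(ℝ, E) 𝓘(ℝ, E →L[ℝ] E →L[ℝ] ℝ) ∞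
      (fun x : M => localFundamentalTensor (F.inChart e) (e x, y₀)) x₀ :=
    hg.contMDiffAt.comp x₀ (contMDiffAt_of_mem_maximalAtlas he hx₀)
  refine hsm.congr_of_eventuallyEq ?_
  filter_upwards [e.open_source.mem_nhds hx₀] with x hx
  obtain ⟨A, hA⟩ := exists_equiv_mfderiv_symm he (e.map_source hx)
  -- The trivialization of the tangent bundle at `x₀` is the derivative of the chart `e`.
  have hsymm : ∀ v : E, (trivializationAt E (TangentSpace 𝓘(ℝ, E)) x₀).symm x v = A v := by
    intro v
    have hr : Set.range 𝓘(ℝ, E) = Set.univ := by simp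
    have h := TangentBundle.symmL_trivializationAt (I := 𝓘(ℝ, E)) hx
    rw [hr, mfderivWithin_univ] at h
    rw [← hA, ← Bundle.Trivialization.symmL_apply (R := ℝ) _ (by simpa using hx)]
    exact DFunLike.congr_fun h v
  ext v w
  rw [localFundamentalTensor_inChart he (e.map_source hx) hy₀ hA]
  refine (inCoordinates_apply_eq₂ (F₁ := E) (F₂ := E) (F₃ := ℝ) (E₃ := fun _ => ℝ)
    ?_ ?_ ?_).trans ?_
  · simpa using hx
  · simpa using hx
  · simp
  · rw [hsymm, hsymm]
    rw [e.left_inv hx, hF x (A y₀) (A.map_ne_zero_iff.2 hy₀)]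
    simp
    rfl

/-- On a manifold of dimension at least two, `E ∖ 0` is connected, so that the fundamental tensor
does not depend on the direction once the Cartan tensor vanishes. -/
lemma fundamentalTensor_eq_of_cartanTensor_eq_zero (hE : 1 < Module.rank ℝ E)
    {F : FinslerMetric E M} (hF : ∀ (x : M) (y : E), y ≠ 0 → F.cartanTensor x y = 0) (x : M)
    {y y' : E} (hy : y ≠ 0) (hy' : y' ≠ 0) :
    F.fundamentalTensor x y = F.fundamentalTensor x y' := by
  refine isOpen_compl_singleton.is_const_of_fderiv_eq_zero (𝕜 := ℝ) (s := {0}ᶜ)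
    (isConnected_compl_singleton_of_one_lt_rank hE 0).isPreconnected
    (fun z hz => ((F.contDiffAt_fundamentalTensor x hz).differentiableAt
      (by simp)).differentiableWithinAt) (fun z hz => ?_) hy hy'
  ext u v w
  have h : (1 / 2 : ℝ) * fderiv ℝ (F.fundamentalTensor x) z u v w = 0 :=
    congrArg (fun T : E →L[ℝ] E →L[ℝ] E →L[ℝ] ℝ => T u v w) (hF x z hz)
  simpa using h

/-- If the Cartan tensor vanishes, the fundamental tensor is the desired Riemannian metric. -/
lemma isRiemannian_of_cartanTensor_eq_zero [FiniteDimensional ℝ E]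
    (hE : 2 ≤ Module.finrank ℝ E) {F : FinslerMetric E M}
    (hF : ∀ (x : M) (y : E), y ≠ 0 → F.cartanTensor x y = 0) : F.IsRiemannian := by
  have hrank : 1 < Module.rank ℝ E := by
    rw [← Module.finrank_eq_rank]; exact_mod_cast hE
  have : Nontrivial E := Module.nontrivial_of_finrank_pos (R := ℝ) (by omega)
  obtain ⟨y₀, hy₀⟩ := exists_ne (0 : E)
  have hconst : ∀ (x : M) (y : E), y ≠ 0 → F.fundamentalTensor x y = F.fundamentalTensor x y₀ :=
    fun x y hy => fundamentalTensor_eq_of_cartanTensor_eq_zero hrank hF x hy hy₀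
  refine ⟨{
    inner := fun x => F.fundamentalTensor x y₀
    symm := fun x v w => F.fundamentalTensor_symm x hy₀ v w
    pos := fun x v hv => F.posDef x y₀ v hy₀ hv
    isVonNBounded := fun x => isVonNBounded_setOf_lt_one (V := E)
      fun v hv => F.posDef x y₀ v hy₀ hv
    contMDiff := F.contMDiff_fundamentalTensor hy₀ hconst }, fun x v => ?_⟩
  change F.toFun ⟨x, v⟩ ^ 2 = F.fundamentalTensor x y₀ v v
  by_cases hv : v = 0
  · rw [hv, F.toFun_zero]
    have : F.fundamentalTensor x y₀ (0 : E) (0 : E) = 0 := by simp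
    exact (zero_pow two_ne_zero).trans this.symm
  · rw [← hconst x v hv]
    exact (F.fundamentalTensor_self x hv).symm

end FinslerMetric

theorem mainTheorem2 {E : Type*} [NormedAddCommGroup E] [NormedSpace ℝ E] [FiniteDimensional ℝ E]
    (hn : 2 ≤ Module.finrank ℝ E)
    {M : Type*} [TopologicalSpace M] [ChartedSpace E M] [IsManifold 𝓘(ℝ, E) ∞ M]
    (F : FinslerMetric E M) :
    (F.SasakiIsBundleLikeForVPrime ↔ F.IsRiemannian) ∧
    (F.IsRiemannian ↔ ∀ (x : M) (y : E), y ≠ 0 → F.cartanTensor x y = 0) := by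
  have hR : F.IsRiemannian ↔ ∀ (x : M) (y : E), y ≠ 0 → F.cartanTensor x y = 0 :=
    ⟨fun h x y _ => F.cartanTensor_eq_zero_of_isRiemannian h x y,
      F.isRiemannian_of_cartanTensor_eq_zero hn⟩
  refine ⟨?_, hR⟩
  rw [hR, F.cartanTensor_eq_zero_iff]
  exact forall₂_congr fun e he => isBundleLikeOn_localSasaki_iff (F.isLocalFinsler_inChart he)
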